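/- Throughout, $x^w = w^{-1}xw$ and $X^w=\{x^w : x\in X\}$. A subgroup $H$ of a finitely generated group $G$ is called *benign* in $G$ if $G$ can be embedded in a finitely presented group $K$ having a finitely generated subgroup $L\le K$ with $G\cap L=H$. For groups $M\le K_1,\dots,K_r$ ($r\ge 1$) with subgroups $L_i\le K_i$, let $K_i *_{L_i} t_i=\langle K_i,t_i \mid l^{t_i}=l \text{ for all } l\in L_i\rangle$ be the HNN-extension whose stable letter $t_i$ fixes $L_i$ elementwise, and let $$\text{✶}_{i=1}^r(K_i,L_i,t_i)_M=\Big(\cdots\big((K_1 *_{L_1} t_1)*_M(K_2 *_{L_2} t_2)\big)*_M\cdots\Big)*_M(K_r *_{L_r} t_r)$$ be the nested free product with the common subgroup $M$ amalgamated. **Corollary 4.5.** Let $r\ge1$ and let $A_1,\dots,A_r$ be benign subgroups of a finitely generated group $G$. Then: 1. the intersection $I=\bigcap_{i=1}^r A_i$ is benign in $G$; 2. the join $J=\big\langle\bigcup_{i=1}^r A_i\big\rangle$ is benign in $G$. Moreover, overgroups and subgroups witnessing this can be given explicitly. Let $M$ be a finitely generated group with $G\le M$, let $K_1,\dots,K_r$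 be finitely presented groups with $M\le K_i$, and let $L_i\le K_i$ be finitely generated subgroups with $G\cap L_i=A_i$ for all $i$. Put $$K=\text{✶}_{i=1}^r(K_i,L_i,t_i)_M,\qquad L_I=G^{t_1t_2\cdots t_r},\qquad L_J=\langle G^{t_1},\dots,G^{t_r}\rangle .$$ Then $K$ is finitely presented, $G$ embeds in $K$ (through $M$), $L_I$ and $L_J$ are finitely generated, and in $K$ $$G\cap L_I=I,\qquad G\cap L_J=J .$$ Explicitly: if $K_i=\langle X_i\mid R_i\rangle$ are finite presentations, $W_i$ is a finite set of words in $X_i^{\pm1}$ representing generators of $L_i$, $(g_s)_{s\in S}$ is a finite family of generators of $M$, and $m_{i,s}$ is a word in $X_i^{\pm1}$ representing $g_s$ in $K_i$, then $K$ has the finite presentation $$K=\Big\langle \textstyle\bigsqcup_i X_i,\ t_1,\dots,t_r\ \Big|\ \bigcup_i R_i;\ \ t_i^{-1}wt_i=w\ (1\le i\le r,\ w\in W_i);\ \ m_{i,s}=m_{j,s}\ (1\le i,j\le r,\ s\in S)\Big\rangle$$ on the natural generators. -/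

import Mathlib

universe u

/-- `g ^ w = w⁻¹ g w` applied to a whole subgroup: `H ^ w = {w⁻¹ h w | h ∈ H}`. -/
def Subgroup.conjBy {K : Type u} [Group K] (H : Subgroup K) (w : K) : Subgroup K :=
  H.map (MulAut.conj w⁻¹).toMonoidHom

/-- A subgroup `H` of a (finitely generated) group `G` is benign in `G` if `G` embeds in a finitely
presented group `K` having a finitely generated subgroup `L` such that `G ∩ L = H`; here `G` is
identified with its image under the embedding `ι`, so that `G ∩ L` is `L.comap ι`.
(A finitely presented group is countable, so nothing depends on the universe of `K`.) -/
def Subgroup.IsBenign {G : Type u} [Group G] (H : Subgroup G) : Prop :=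
  ∃ (K : Type u) (_ : Group K) (ι : G →* K) (L : Subgroup K),
    Group.IsFinitelyPresented K ∧ Function.Injective ι ∧ L.FG ∧ L.comap ι = H

namespace StarConstruction

/-- A group together with a homomorphism from `M`. It is an overgroup of `M` when `hom` is
injective. -/
structure GroupOver (M : Type u) [Group M] where
  carrier : Type u
  [group : Group carrier]
  hom : M →* carrier

attribute [instance] GroupOver.group

/-- The two-element family with members `X` and `Y`. -/
def pair {M : Type u} [Group M] (X Y : GroupOver M) : Bool → GroupOver M
  | false => X
  | true => Y

/-- The generalized free product `X *_M Y` of two groups with `M` amalgamated, considered again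
with its canonical map from `M`. -/
def amalgam {M : Type u} [Group M] (X Y : GroupOver M) : GroupOver M where
  carrier := Monoid.PushoutI fun b => (pair X Y b).hom
  hom := Monoid.PushoutI.base fun b => (pair X Y b).hom

/-- The canonical map `X → X *_M Y`. -/
def amalgam.inl {M : Type u} [Group M] (X Y : GroupOver M) :
    X.carrier →* (amalgam X Y).carrier :=
  Monoid.PushoutI.of (φ := fun b => (pair X Y b).hom) false

/-- The canonical map `Y → X *_M Y`. -/
def amalgam.inr {M : Type u} [Group M] (X Y : GroupOver M) :
    Y.carrier →* (amalgam X Y).carrier :=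
  Monoid.PushoutI.of (φ := fun b => (pair X Y b).hom) true

/-- The nested amalgam `(⋯((X₀ *_M X₁) *_M X₂)⋯) *_M Xₙ`. -/
def nested {M : Type u} [Group M] : (n : ℕ) → (Fin (n + 1) → GroupOver M) → GroupOver M
  | 0, X => X 0
  | n + 1, X => amalgam (nested n fun i => X i.castSucc) (X (Fin.last (n + 1)))

/-- The canonical maps of the factors into the nested amalgam. -/
def nestedIn {M : Type u} [Group M] : (n : ℕ) → (X : Fin (n + 1) → GroupOver M) →
    (i : Fin (n + 1)) → (X i).carrier →* (nested n X).carrier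
  | 0, X, i => Fin.cases (motive := fun i => (X i).carrier →* (X 0).carrier)
      (MonoidHom.id (X 0).carrier) (fun j => j.elim0) i
  | n + 1, X, i => Fin.lastCases
      (motive := fun i => (X i).carrier →*
        (amalgam (nested n fun i => X i.castSucc) (X (Fin.last (n + 1)))).carrier)
      (amalgam.inr (nested n fun i => X i.castSucc) (X (Fin.last (n + 1))))
      (fun j => (amalgam.inl (nested n fun i => X i.castSucc) (X (Fin.last (n + 1)))).comp
        (nestedIn n (fun i => X i.castSucc) j)) i

section Star

variable {M : Type u} [Group M] {n : ℕ} {K : Fin (n + 1) → Type u} [∀ i, Group (K i)]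

/-- The HNN-extension `K_i *_{L_i} t_i` in which the stable letter `t_i` fixes `L_i` elementwise,
considered with its map from `M` through `K_i`. -/
def factor (φ : ∀ i, M →* K i) (L : ∀ i, Subgroup (K i)) (i : Fin (n + 1)) : GroupOver M where
  carrier := HNNExtension (K i) (L i) (L i) (MulEquiv.refl (L i))
  hom := HNNExtension.of.comp (φ i)

/-- The canonical embedding of `K_i` into `K_i *_{L_i} t_i`. -/
def factorOf (φ : ∀ i, M →* K i) (L : ∀ i, Subgroup (K i)) (i : Fin (n + 1)) :
    K i →* (factor φ L i).carrier :=
  (HNNExtension.of : K i →* HNNExtension (K i) (L i) (L i) (MulEquiv.refl (L i)))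

/-- The stable letter `t_i` of `K_i *_{L_i} t_i`. -/
def factorT (φ : ∀ i, M →* K i) (L : ∀ i, Subgroup (K i)) (i : Fin (n + 1)) :
    (factor φ L i).carrier :=
  (HNNExtension.t : HNNExtension (K i) (L i) (L i) (MulEquiv.refl (L i)))

/-- The star construction on the groups `K_i`, their subgroups `L_i` and stable letters `t_i`, with
amalgamated subgroup `M`: the nested free product, with `M` amalgamated, of the HNN-extensions
`K_i *_{L_i} t_i`. The number of factors is `r = n + 1`. -/
def Star (φ : ∀ i, M →* K i) (L : ∀ i, Subgroup (K i)) : Type u :=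
  (nested n (factor φ L)).carrier

instance (φ : ∀ i, M →* K i) (L : ∀ i, Subgroup (K i)) : Group (Star φ L) :=
  inferInstanceAs (Group (nested n (factor φ L)).carrier)

/-- The canonical map of the amalgamated subgroup `M` into the star construction. -/
def Star.base (φ : ∀ i, M →* K i) (L : ∀ i, Subgroup (K i)) : M →* Star φ L :=
  (nested n (factor φ L)).hom

/-- The canonical map of `K_i` into the star construction. -/
def Star.of (φ : ∀ i, M →* K i) (L : ∀ i, Subgroup (K i)) (i : Fin (n + 1)) : K i →* Star φ L :=
  (nestedIn n (factor φ L) i).comp (factorOf φ L i)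

/-- The stable letter `t_i` in the star construction. -/
def Star.t (φ : ∀ i, M →* K i) (L : ∀ i, Subgroup (K i)) (i : Fin (n + 1)) : Star φ L :=
  nestedIn n (factor φ L) i (factorT φ L i)

end Star

section Presentation

variable {n : ℕ} {α : Fin (n + 1) → Type} {σ : Type}

/-- A word in the generators of `K_i`, read as a word in all generators of the star construction:
the generators of all the `K_i` and the stable letters `t_0, …, t_n`. -/
def inclWord (i : Fin (n + 1)) :
    FreeGroup (α i) →* FreeGroup ((Σ i, α i) ⊕ Fin (n + 1)) :=
  FreeGroup.map fun a => Sum.inl ⟨i, a⟩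

/-- The defining relators of the star construction, for groups `K_i` with generators `α i` and
relators `R i`, words `W i` generating `L_i`, and words `m i s` (`s : σ`) representing in `K_i` the
generators of `M`: the relators of each `K_i`, the relators saying that `t_i` commutes with the
generators of `L_i`, and those identifying the copies of `M` in `K_i` and `K_j`. -/
def starRelators (R W : ∀ i, Set (FreeGroup (α i))) (m : ∀ i, σ → FreeGroup (α i)) :
    Set (FreeGroup ((Σ i, α i) ⊕ Fin (n + 1))) :=
  {x | ∃ i, ∃ r ∈ R i, x = inclWord i r} ∪
  {x | ∃ i, ∃ w ∈ W i, x = (FreeGroup.of (Sum.inr i))⁻¹ * inclWord i w *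
      FreeGroup.of (Sum.inr i) * (inclWord i w)⁻¹} ∪
  {x | ∃ i j s, x = inclWord i (m i s) * (inclWord j (m j s))⁻¹}

end Presentation

/-- The evaluation of words in the generators of the `K_i` and in the stable letters in the star
construction, where `π i` is the evaluation of words in `K_i`. -/
def Star.eval {M : Type u} [Group M] {n : ℕ} {K : Fin (n + 1) → Type u} [∀ i, Group (K i)]
    (φ : ∀ i, M →* K i) (L : ∀ i, Subgroup (K i)) {α : Fin (n + 1) → Type}
    (π : ∀ i, FreeGroup (α i) →* K i) :
    FreeGroup ((Σ i, α i) ⊕ Fin (n + 1)) →* Star φ L :=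
  FreeGroup.lift (Sum.elim (fun p => Star.of φ L p.1 (π p.1 (FreeGroup.of p.2))) (Star.t φ L))

end StarConstruction

/-! Everything rests on one picture of a single HNN-extension `K *_L t` in which `t` fixes `L`. It
maps to the holomorph of the double `K *_L K`, with `K` going to the first copy and conjugation by
`t` exchanging the copies. So `K ^ t` becomes the second copy, and questions about `K` and `K ^ t`
become questions about an amalgamated product.

Intersection: the two copies of `K` meet only in `L`, so `x ^ t` lies in `K` exactly when `x` is in
`L`, and then `x ^ t = x`. In the nested amalgam, different factors meet in `M`. Hence if `g ^ (t_1
⋯ t_r)` is in `M`, then stripping off the last letter leaves an element of two factors, thus of `M`,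
and by induction every `t_i` fixes `g`. This is `conj_prod_ofFn_nestedIn_iff`.

Join: subgroups of the factors with the same trace `P` on the amalgamated subgroup generate their
own amalgam over `P`, so the join meets each factor in nothing new (`mem_of_of_mem_iSup_map`).
Applied to the double this gives `⟨J, G ^ t_i⟩ ∩ M = J` in each factor; applied to the nested
amalgam it bounds the trace of `L_J`. Conversely `t_i` fixes `A_i`, which puts `A_i` inside `G ^
t_i`.

The presentation follows from the universal properties of the amalgams and HNN-extensions. -/

namespace Monoid.PushoutI

/-! ### Reduced words and subamalgams of an amalgamated product. -/

open NormalWord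

variable {ι : Type*} {G : ι → Type*} {H : Type*} [∀ i, Group (G i)] [Group H] {φ : ∀ i, H →* G i}

/-- In the pushout, an element of a factor that is a nontrivial multiple of a reduced word starting
in another factor is not trivial. -/
theorem Reduced.of_mul_prod_eq_one (hφ : ∀ i, Function.Injective (φ i)) {w : CoprodI.Word G}
    (hw : Reduced φ w) {i : ι} (hi : w.fstIdx ≠ some i) {y : G i}
    (h : of i y * ofCoprodI (φ := φ) w.prod = 1) : y = 1 := by
  classical
  by_cases hy : y ∈ (φ i).range
  · obtain ⟨z, rfl⟩ := hy
    have hwe : w = .empty := by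
      refine hw.eq_empty_of_mem_range hφ ⟨z⁻¹, ?_⟩
      rw [← of_apply_eq_base φ i, map_inv, map_inv]
      exact (eq_inv_of_mul_eq_one_right h).symm
    subst hwe
    rw [CoprodI.Word.prod_empty, map_one, mul_one] at h
    exact of_injective hφ i (h.trans (map_one _).symm)
  · have hy1 : y ≠ 1 := fun h1 => hy (h1 ▸ one_mem _)
    -- Outside the amalgamated subgroup, `y` can be prepended to `w`: the result is a nonempty
    -- reduced word, which cannot have product 1.
    have hred : Reduced φ (CoprodI.Word.cons y w hi hy1) := by
      intro g hg
      rcases List.mem_cons.1 hg with rfl | hg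
      · exact hy
      · exact hw g hg
    have hwe := hred.eq_empty_of_mem_range hφ (by
      rw [CoprodI.Word.prod_cons, map_mul, ofCoprodI_of, h]
      exact one_mem _)
    exact absurd (congrArg CoprodI.Word.toList hwe) (List.cons_ne_nil _ _)

/-- The amalgamated part of a normal form is absorbed into the letter from factor `i` (possibly
trivial), so that the remaining tail does not start in that factor. -/
theorem NormalWord.prod_eq_of_mul_prod_tail [DecidableEq ι] [∀ i, DecidableEq (G i)]
    {d : Transversal φ} (w : NormalWord d) (i : ι) :
    w.prod = of i (equivPair i w).head * ofCoprodI (equivPair i w).tail.prod := by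
  have h : CoprodI.of (φ i w.head) • w.toWord =
      CoprodI.of (equivPair i w).head • (equivPair i w).tail := by
    rw [← CoprodI.Word.rcons_eq_smul, ← CoprodI.Word.equivPair_symm, Equiv.eq_symm_apply]
    rfl
  have h' := congrArg (fun v => ofCoprodI (φ := φ) (CoprodI.Word.prod v)) h
  simp only [CoprodI.Word.prod_smul, map_mul, ofCoprodI_of, of_apply_eq_base] at h'
  exact h'

/-- Subgroups of the factors of an amalgamated product that meet the amalgamated subgroup in a
common subgroup generate a subgroup meeting each factor in the given subgroup. -/
theorem mem_of_of_mem_iSup_map (hφ : ∀ i, Function.Injective (φ i)) (S : ∀ i, Subgroup (G i))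
    (P : Subgroup H) (hP : ∀ i, (S i).comap (φ i) = P) {i : ι} {x : G i}
    (hx : of (φ := φ) i x ∈ ⨆ j, (S j).map (of (φ := φ) j)) : x ∈ S i := by
  classical
  have hPS : ∀ j (p : P), φ j p ∈ S j := fun j p => (hP j).ge p.2
  let ψ : ∀ j, P →* S j := fun j => ((φ j).comp P.subtype).codRestrict (S j) (hPS j)
  have hψ : ∀ j, Function.Injective (ψ j) := fun j a b hab =>
    Subtype.ext (hφ j (congrArg Subtype.val hab))
  -- The abstract amalgam of the `S j` over `P` maps onto a subgroup containing their join; a normal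
  -- form of a preimage of `x` is compared with `x` through this map.
  let F : PushoutI ψ →* PushoutI φ :=
    lift (fun j => (of j).comp (S j).subtype) ((base φ).comp P.subtype) (by
      intro j
      ext p
      exact of_apply_eq_base φ j p)
  have hF : (⨆ j, (S j).map (of (φ := φ) j)) ≤ F.range := by
    refine iSup_le fun j => ?_
    rintro _ ⟨s, hs, rfl⟩
    exact ⟨of j ⟨s, hs⟩, lift_of _ _ _ _⟩
  obtain ⟨q, hq⟩ := hF hx
  obtain ⟨d⟩ := transversal_nonempty ψ hψ
  obtain ⟨w, rfl⟩ : ∃ w : NormalWord d, w.prod = q := ⟨_, (equiv (d := d)).symm_apply_apply q⟩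
  let p := equivPair i w
  have hw : w.prod = of i p.head * ofCoprodI p.tail.prod := w.prod_eq_of_mul_prod_tail i
  -- The tail of the normal form, with its letters read in the larger groups `G j`.
  let v : CoprodI.Word G :=
    ⟨p.tail.toList.map fun l => ⟨l.1, l.2⟩, by
      simp only [List.mem_map, forall_exists_index, and_imp]
      rintro _ l hl rfl h1
      exact p.tail.ne_one l hl (Subtype.ext h1), by
      simpa [List.isChain_map] using p.tail.chain_ne⟩
  have hv : ofCoprodI v.prod = F (ofCoprodI p.tail.prod) := by
    simp only [v, CoprodI.Word.prod, map_list_prod, List.map_map]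
    congr 1
  -- A letter of `S j` lying in the image of `H` comes from `P`, by the hypothesis on traces. Its
  -- coset representative is then 1; but letters of a normal form are their own representatives and
  -- nontrivial.
  have hvr : Reduced φ v := by
    simp only [Reduced, v, List.mem_map, forall_exists_index, and_imp]
    rintro _ l hl rfl ⟨m, hm⟩
    have hmP : m ∈ P := by
      rw [← hP l.1, Subgroup.mem_comap, hm]
      exact l.2.2
    have hlm : l.2 ∈ (ψ l.1).range := ⟨⟨m, hmP⟩, Subtype.ext hm⟩
    refine p.tail.ne_one l hl ?_
    have h1 := (d.compl l.1).coe_equiv_snd_eq_one_iff_mem (d.one_mem _) |>.2 hlm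
    rwa [((d.compl l.1).equiv_snd_eq_self_iff_mem (one_mem _)).2 (p.normalized _ _ hl)] at h1
  have hvi : v.fstIdx ≠ some i := by
    have := p.fstIdx_ne
    simpa [CoprodI.Word.fstIdx, v, List.head?_map, Option.map_map, Function.comp_def] using this
  have key : x⁻¹ * (p.head : G i) = 1 := by
    refine hvr.of_mul_prod_eq_one hφ hvi ?_
    rw [hv, map_mul, map_inv, ← hq, hw, map_mul, mul_assoc]
    have : F (of i p.head) = of i (p.head : G i) := lift_of _ _ _ _
    rw [← this]
    group
  rw [inv_mul_eq_one.1 key]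
  exact p.head.2

end Monoid.PushoutI

/-! ### HNN-extensions whose stable letter fixes the associated subgroup, via the double. -/

namespace HNNExtension

open Monoid SemidirectProduct

variable {K : Type*} [Group K] (L : Subgroup K)

/-- The amalgamated square `K *_L K`. -/
abbrev Double : Type _ := PushoutI fun _ : Bool => L.subtype

/-- The two embeddings of `K` into `K *_L K`. -/
def Double.of (b : Bool) : K →* Double L :=
  PushoutI.of (φ := fun _ : Bool => L.subtype) b

theorem Double.of_injective (b : Bool) : Function.Injective (of L b) :=
  PushoutI.of_injective (φ := fun _ : Bool => L.subtype) (fun _ => L.subtype_injective) b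

theorem Double.of_coe (b : Bool) (l : L) :
    of L b l = PushoutI.base (fun _ : Bool => L.subtype) l :=
  PushoutI.of_apply_eq_base (fun _ : Bool => L.subtype) b l

/-- The endomorphism of `K *_L K` that exchanges the factors. -/
def Double.swapHom : Double L →* Double L :=
  PushoutI.lift (fun b => of L !b) (PushoutI.base _) fun b => MonoidHom.ext (of_coe L !b)

theorem Double.swapHom_of (b : Bool) (x : K) : swapHom L (of L b x) = of L (!b) x :=
  PushoutI.lift_of (φ := fun _ : Bool => L.subtype) (fun b => of L !b) _ _ x

theorem Double.swapHom_comp_swapHom : (swapHom L).comp (swapHom L) = MonoidHom.id _ := by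
  refine PushoutI.hom_ext_nonempty fun b => MonoidHom.ext fun x => ?_
  have h : swapHom L (swapHom L (of L b x)) = of L b x := by
    rw [swapHom_of, swapHom_of, Bool.not_not]
  exact h

/-- The automorphism of `K *_L K` that exchanges the factors. -/
def Double.swap : MulAut (Double L) :=
  MonoidHom.toMulEquiv _ _ (swapHom_comp_swapHom L) (swapHom_comp_swapHom L)

/-- The holomorph of `K *_L K`. -/
abbrev Holomorph : Type _ := Double L ⋊[MonoidHom.id (MulAut (Double L))] MulAut (Double L)

theorem inr_swap_mul_inl (x : Double L) :
    (inr (Double.swap L) * inl x * (inr (Double.swap L))⁻¹ : Holomorph L) =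
      inl (Double.swapHom L x) := by
  rw [← map_inv]
  exact (inl_aut (φ := MonoidHom.id (MulAut (Double L))) _ _).symm

/-- The homomorphism from the HNN-extension of `K` by a letter fixing `L` to the holomorph of
`K *_L K` that sends the stable letter to the exchange of the factors. -/
def toHolomorph : HNNExtension K L L (MulEquiv.refl L) →* Holomorph L :=
  lift (inl.comp (Double.of L false)) (inr (Double.swap L))⁻¹ (by
    intro a
    rw [inv_mul_eq_iff_eq_mul, ← mul_assoc, eq_mul_inv_iff_mul_eq, eq_comm,
      ← mul_inv_eq_iff_eq_mul]
    rw [MonoidHom.comp_apply, MonoidHom.comp_apply, inr_swap_mul_inl, Double.swapHom_of,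
      MulEquiv.refl_apply, Double.of_coe, Double.of_coe])

theorem toHolomorph_of (x : K) : toHolomorph L (of x) = inl (Double.of L false x) :=
  lift_of (φ := MulEquiv.refl L) _ _ _ x

/-- Since `t` goes to the inverse of the exchange, conjugation by `t` moves the first copy of `K` to
the second. -/
theorem toHolomorph_conj (x : K) :
    toHolomorph L (t⁻¹ * of x * t) = inl (Double.of L true x) := by
  have ht : toHolomorph L t = (inr (Double.swap L))⁻¹ := lift_t (φ := MulEquiv.refl L) _ _ _
  rw [map_mul, map_mul, map_inv, toHolomorph_of, ht, inv_inv, inr_swap_mul_inl,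
    Double.swapHom_of, Bool.not_false]

variable {L}

theorem inv_t_mul_of_mul_t {x : K} (hx : x ∈ L) :
    (t⁻¹ * of x * t : HNNExtension K L L (MulEquiv.refl L)) = of x := by
  have := t_mul_of (φ := MulEquiv.refl L) ⟨x, hx⟩
  rw [mul_assoc, inv_mul_eq_iff_eq_mul]
  exact this.symm

/-- In the double the equation identifies an element of the second copy with one of the first, and
the copies meet only in `L`. -/
theorem inv_t_mul_of_mul_t_eq_of_iff {x y : K} :
    (t⁻¹ * of x * t : HNNExtension K L L (MulEquiv.refl L)) = of y ↔ x = y ∧ x ∈ L := by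
  refine ⟨fun h => ?_, fun ⟨hxy, hx⟩ => hxy ▸ inv_t_mul_of_mul_t hx⟩
  have h1 := congrArg (toHolomorph L) h
  rw [toHolomorph_conj, toHolomorph_of] at h1
  have h2 := inl_injective h1
  obtain ⟨l, hl⟩ := (PushoutI.inf_of_range_eq_base_range (φ := fun _ : Bool => L.subtype)
    (fun _ => L.subtype_injective) (i := true) (j := false) (by decide)).le
    ⟨⟨x, rfl⟩, ⟨y, h2.symm⟩⟩
  have hx : (l : K) = x := Double.of_injective L true ((Double.of_coe L true l).trans hl)
  have hy : (l : K) = y :=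
    Double.of_injective L false ((Double.of_coe L false l).trans (hl.trans h2))
  exact ⟨hx.symm.trans hy, hx ▸ l.2⟩

/-- Subgroups `J` and `H` of `K` with the same intersection with `L` satisfy `⟨J, H ^ t⟩ ∩ K = J` in
the HNN-extension. -/
theorem mem_of_of_mem_sup_conjBy {J H : Subgroup K} (hJH : J ⊓ L = H ⊓ L) {x : K}
    (hx : (of x : HNNExtension K L L (MulEquiv.refl L)) ∈ J.map of ⊔ (H.map of).conjBy t) :
    x ∈ J := by
  let S : Bool → Subgroup K := fun b => if b then H else J
  have hle : (J.map of ⊔ (H.map of).conjBy t).map (toHolomorph L) ≤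
      (⨆ b, (S b).map (Double.of L b)).map inl := by
    rw [Subgroup.map_le_iff_le_comap, sup_le_iff]
    constructor
    · rintro _ ⟨y, hy, rfl⟩
      refine ⟨Double.of L false y, ?_, (toHolomorph_of L y).symm⟩
      exact (le_iSup (fun b => (S b).map (Double.of L b)) false)
        ⟨y, hy, rfl⟩
    · rintro _ ⟨_, ⟨y, hy, rfl⟩, rfl⟩
      refine ⟨Double.of L true y, ?_, ?_⟩
      · exact (le_iSup (fun b => (S b).map (Double.of L b)) true)
          ⟨y, hy, rfl⟩
      · rw [← toHolomorph_conj]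
        simp
  obtain ⟨z, hz, hzx⟩ := hle ⟨_, hx, rfl⟩
  rw [toHolomorph_of] at hzx
  rw [inl_injective hzx] at hz
  -- The common trace on `L` is `J ⊓ L`, which equals `H ⊓ L` by `hJH`.
  refine PushoutI.mem_of_of_mem_iSup_map (φ := fun _ : Bool => L.subtype)
    (fun _ => L.subtype_injective) S (J.comap L.subtype) (fun b => ?_) (i := false) hz
  cases b
  · rfl
  · ext l
    have : (l : K) ∈ J ⊓ L ↔ (l : K) ∈ H ⊓ L := by rw [hJH]
    simp only [Subgroup.mem_inf, SetLike.coe_mem, and_true] at this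
    exact this.symm

end HNNExtension

/-! ### Nested amalgams over a common subgroup. -/

namespace StarConstruction

open Monoid

variable {M : Type u} [Group M]

section Nested

theorem pair_hom_injective {X Y : GroupOver M} (hX : Function.Injective X.hom)
    (hY : Function.Injective Y.hom) (b : Bool) : Function.Injective (pair X Y b).hom := by
  cases b
  exacts [hX, hY]

theorem amalgam.inl_hom (X Y : GroupOver M) (m : M) :
    amalgam.inl X Y (X.hom m) = (amalgam X Y).hom m :=
  PushoutI.of_apply_eq_base (fun b => (pair X Y b).hom) false m

theorem amalgam.inr_hom (X Y : GroupOver M) (m : M) :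
    amalgam.inr X Y (Y.hom m) = (amalgam X Y).hom m :=
  PushoutI.of_apply_eq_base (fun b => (pair X Y b).hom) true m

theorem amalgam.inl_injective {X Y : GroupOver M} (hX : Function.Injective X.hom)
    (hY : Function.Injective Y.hom) : Function.Injective (amalgam.inl X Y) :=
  PushoutI.of_injective (pair_hom_injective hX hY) false

theorem amalgam.inr_injective {X Y : GroupOver M} (hX : Function.Injective X.hom)
    (hY : Function.Injective Y.hom) : Function.Injective (amalgam.inr X Y) :=
  PushoutI.of_injective (pair_hom_injective hX hY) true

theorem amalgam.hom_injective {X Y : GroupOver M} (hX : Function.Injective X.hom)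
    (hY : Function.Injective Y.hom) : Function.Injective (amalgam X Y).hom :=
  PushoutI.base_injective (pair_hom_injective hX hY)

/-- In `X *_M Y` the factors meet in `M`. -/
theorem amalgam.exists_hom_eq {X Y : GroupOver M} (hX : Function.Injective X.hom)
    (hY : Function.Injective Y.hom) {x : X.carrier} {y : Y.carrier}
    (h : amalgam.inl X Y x = amalgam.inr X Y y) : ∃ m, X.hom m = x ∧ Y.hom m = y := by
  obtain ⟨m, hm⟩ := (PushoutI.inf_of_range_eq_base_range (pair_hom_injective hX hY)
    (i := false) (j := true) (by decide)).le ⟨⟨x, rfl⟩, ⟨y, h.symm⟩⟩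
  refine ⟨m, inl_injective hX hY ?_, inr_injective hX hY ?_⟩
  · exact (amalgam.inl_hom X Y m).trans hm
  · exact (amalgam.inr_hom X Y m).trans (hm.trans h)

theorem amalgam.exists_lift {Q : Type*} [Group Q] {X Y : GroupOver M} (b : M →* Q)
    (f : X.carrier →* Q) (g : Y.carrier →* Q) (hf : f.comp X.hom = b) (hg : g.comp Y.hom = b) :
    ∃ F : (amalgam X Y).carrier →* Q, F.comp (amalgam X Y).hom = b ∧
      F.comp (amalgam.inl X Y) = f ∧ F.comp (amalgam.inr X Y) = g := by
  let k : ∀ c, (pair X Y c).carrier →* Q := fun c => match c with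
    | false => f
    | true => g
  have hk : ∀ c, (k c).comp (pair X Y c).hom = b := by
    rintro (_ | _)
    exacts [hf, hg]
  exact ⟨PushoutI.lift k b hk, MonoidHom.ext fun m => PushoutI.lift_base k b hk m,
    MonoidHom.ext fun x => PushoutI.lift_of k b hk (i := false) x,
    MonoidHom.ext fun x => PushoutI.lift_of k b hk (i := true) x⟩

theorem amalgam.range_inl_sup_range_inr (X Y : GroupOver M) :
    (amalgam.inl X Y).range ⊔ (amalgam.inr X Y).range = ⊤ := by
  rw [eq_top_iff]
  rintro z -
  induction z using PushoutI.induction_on with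
  | of b x =>
    cases b
    · exact Subgroup.mem_sup_left ⟨x, rfl⟩
    · exact Subgroup.mem_sup_right ⟨x, rfl⟩
  | base m => exact Subgroup.mem_sup_left ⟨X.hom m, amalgam.inl_hom X Y m⟩
  | mul x y hx hy => exact mul_mem hx hy

/-- Subgroups of `X` and `Y` meeting `M` in `P` generate a subgroup of `X *_M Y` meeting `M`
in `P`. -/
theorem amalgam.comap_sup_map {X Y : GroupOver M} (hX : Function.Injective X.hom)
    (hY : Function.Injective Y.hom) {S : Subgroup X.carrier} {T : Subgroup Y.carrier}
    {P : Subgroup M} (hS : S.comap X.hom = P) (hT : T.comap Y.hom = P) :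
    (S.map (amalgam.inl X Y) ⊔ T.map (amalgam.inr X Y)).comap (amalgam X Y).hom = P := by
  refine le_antisymm (fun m hm => ?_) fun m hm => ?_
  · let U : ∀ c, Subgroup (pair X Y c).carrier := fun c => match c with
      | false => S
      | true => T
    have hU : ∀ c, (U c).comap (pair X Y c).hom = P := by
      rintro (_ | _)
      exacts [hS, hT]
    have hle : S.map (amalgam.inl X Y) ⊔ T.map (amalgam.inr X Y) ≤
        ⨆ c, (U c).map (PushoutI.of (φ := fun b => (pair X Y b).hom) c) :=
      sup_le (le_iSup (fun c => (U c).map (PushoutI.of (φ := fun b => (pair X Y b).hom) c)) false)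
        (le_iSup (fun c => (U c).map (PushoutI.of (φ := fun b => (pair X Y b).hom) c)) true)
    have h1 : amalgam.inl X Y (X.hom m) ∈
        ⨆ c, (U c).map (PushoutI.of (φ := fun b => (pair X Y b).hom) c) := by
      rw [amalgam.inl_hom]
      exact hle hm
    have h2 : X.hom m ∈ S := PushoutI.mem_of_of_mem_iSup_map (pair_hom_injective hX hY) U P hU
      (i := false) h1
    rw [← hS]
    exact h2
  · rw [← hS] at hm
    exact Subgroup.mem_sup_left ⟨X.hom m, hm, amalgam.inl_hom X Y m⟩

/-- The embedding of the nested amalgam of all factors but the last. -/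
def nestedInit {n : ℕ} (X : Fin (n + 2) → GroupOver M) :
    (nested n fun i => X i.castSucc).carrier →* (nested (n + 1) X).carrier :=
  amalgam.inl (nested n fun i => X i.castSucc) (X (Fin.last (n + 1)))

theorem nestedIn_castSucc {n : ℕ} (X : Fin (n + 2) → GroupOver M) (i : Fin (n + 1)) :
    nestedIn (n + 1) X i.castSucc =
      (nestedInit X).comp (nestedIn n (fun i => X i.castSucc) i) :=
  Fin.lastCases_castSucc ..

theorem nestedIn_last {n : ℕ} (X : Fin (n + 2) → GroupOver M) :
    nestedIn (n + 1) X (Fin.last (n + 1)) = amalgam.inr (nested n fun i => X i.castSucc)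
      (X (Fin.last (n + 1))) :=
  Fin.lastCases_last ..

theorem nestedInit_hom {n : ℕ} (X : Fin (n + 2) → GroupOver M) (m : M) :
    nestedInit X ((nested n fun i => X i.castSucc).hom m) = (nested (n + 1) X).hom m :=
  amalgam.inl_hom _ _ m

theorem nested_hom_injective : ∀ {n : ℕ} {X : Fin (n + 1) → GroupOver M},
    (∀ i, Function.Injective (X i).hom) → Function.Injective (nested n X).hom
  | 0, _, h => h 0
  | _ + 1, _, h => amalgam.hom_injective (nested_hom_injective fun i => h i.castSucc) (h _)

theorem nestedIn_hom : ∀ {n : ℕ} (X : Fin (n + 1) → GroupOver M) (i : Fin (n + 1)) (m : M),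
    nestedIn n X i ((X i).hom m) = (nested n X).hom m
  | 0, X, i, m => by
    obtain rfl : i = 0 := Fin.fin_one_eq_zero i
    rfl
  | n + 1, X, i, m => by
    induction i using Fin.lastCases with
    | last =>
      rw [nestedIn_last]
      exact amalgam.inr_hom _ _ m
    | cast i =>
      rw [nestedIn_castSucc, MonoidHom.comp_apply, nestedIn_hom (fun i => X i.castSucc) i m]
      exact nestedInit_hom X m

theorem nested_exists_lift {Q : Type*} [Group Q] (b : M →* Q) :
    ∀ {n : ℕ} (X : Fin (n + 1) → GroupOver M) (f : ∀ i, (X i).carrier →* Q),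
    (∀ i, (f i).comp (X i).hom = b) →
    ∃ F : (nested n X).carrier →* Q, F.comp (nested n X).hom = b ∧
      ∀ i, F.comp (nestedIn n X i) = f i
  | 0, X, f, h => ⟨f 0, h 0, fun i => by
      obtain rfl : i = 0 := Fin.fin_one_eq_zero i
      rfl⟩
  | n + 1, X, f, h => by
    obtain ⟨F', hF', hf'⟩ := nested_exists_lift b (fun i => X i.castSucc)
      (fun i => f i.castSucc) fun i => h i.castSucc
    obtain ⟨F, hF, hl, hr⟩ := amalgam.exists_lift b F' (f (Fin.last (n + 1))) hF' (h _)
    refine ⟨F, hF, fun i => ?_⟩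
    induction i using Fin.lastCases with
    | last => rw [nestedIn_last]; exact hr
    | cast i =>
      rw [nestedIn_castSucc, ← hf' i, ← hl]
      rfl

theorem iSup_range_nestedIn : ∀ {n : ℕ} (X : Fin (n + 1) → GroupOver M),
    ⨆ i, (nestedIn n X i).range = ⊤
  | 0, X => by
    rw [eq_top_iff]
    exact le_trans (fun x _ => MonoidHom.mem_range.2 ⟨x, rfl⟩) (le_iSup (fun i => (nestedIn 0 X i).range) 0)
  | n + 1, X => by
    rw [eq_top_iff]
    have htop : (nestedInit X).range ⊔ (nestedIn (n + 1) X (Fin.last (n + 1))).range = ⊤ := by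
      rw [nestedIn_last]
      exact amalgam.range_inl_sup_range_inr _ _
    refine htop.ge.trans (sup_le ?_ ?_)
    · rw [MonoidHom.range_eq_map, ← iSup_range_nestedIn fun i => X i.castSucc, Subgroup.map_iSup]
      refine iSup_le fun i => ?_
      rw [MonoidHom.map_range, ← nestedIn_castSucc]
      exact le_iSup (fun i => (nestedIn (n + 1) X i).range) i.castSucc
    · exact le_iSup (fun i => (nestedIn (n + 1) X i).range) (Fin.last (n + 1))

/-- Subgroups of the factors meeting `M` in `P` generate a subgroup meeting `M` in `P`. -/
theorem comap_iSup_map_nestedIn {P : Subgroup M} : ∀ {n : ℕ} {X : Fin (n + 1) → GroupOver M},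
    (∀ i, Function.Injective (X i).hom) → ∀ S : ∀ i, Subgroup (X i).carrier,
    (∀ i, (S i).comap (X i).hom = P) →
    (⨆ i, (S i).map (nestedIn n X i)).comap (nested n X).hom = P
  | 0, X, _, S, h => by
    rw [ciSup_unique (ι := Fin 1)]
    exact (congrArg (Subgroup.comap (X 0).hom) (Subgroup.map_id (S 0))).trans (h 0)
  | n + 1, X, hX, S, h => by
    have ih := comap_iSup_map_nestedIn (fun i => hX i.castSucc) (fun i => S i.castSucc)
      fun i => h i.castSucc
    have hsup : ((⨆ i : Fin (n + 1), (S i.castSucc).map (nestedIn n (fun i => X i.castSucc) i)).map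
        (nestedInit X) ⊔ (S (Fin.last (n + 1))).map (nestedIn (n + 1) X (Fin.last (n + 1)))).comap
        (nested (n + 1) X).hom = P := by
      rw [nestedIn_last]
      exact amalgam.comap_sup_map (nested_hom_injective fun i => hX i.castSucc) (hX _) ih
        (h (Fin.last (n + 1)))
    refine Eq.trans (congrArg _ ?_) hsup
    rw [Subgroup.map_iSup]
    refine le_antisymm (iSup_le fun i => ?_) (sup_le (iSup_le fun i => ?_) ?_)
    · induction i using Fin.lastCases with
      | last => exact le_sup_right
      | cast i =>
        rw [nestedIn_castSucc, ← Subgroup.map_map]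
        exact le_sup_of_le_left (le_iSup (fun i : Fin (n + 1) => Subgroup.map _
          ((S i.castSucc).map (nestedIn n (fun i => X i.castSucc) i))) i)
    · rw [Subgroup.map_map, ← nestedIn_castSucc]
      exact le_iSup (fun i => (S i).map (nestedIn (n + 1) X i)) i.castSucc
    · exact le_iSup (fun i => (S i).map (nestedIn (n + 1) X i)) (Fin.last (n + 1))

/-- If `s i` conjugates an element of `M` into `M` only by fixing it, and fixes exactly the elements
of `Λ i`, then the product of the `s i` fixes exactly the intersection of the `Λ i`. -/
theorem conj_prod_ofFn_nestedIn_iff : ∀ {n : ℕ} {X : Fin (n + 1) → GroupOver M},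
    (∀ i, Function.Injective (X i).hom) → ∀ (s : ∀ i, (X i).carrier) (Λ : Fin (n + 1) → Subgroup M),
    (∀ i m m', (s i)⁻¹ * (X i).hom m * s i = (X i).hom m' ↔ m = m' ∧ m ∈ Λ i) →
    ∀ m m', (List.ofFn fun i => nestedIn n X i (s i)).prod⁻¹ * (nested n X).hom m *
        (List.ofFn fun i => nestedIn n X i (s i)).prod = (nested n X).hom m' ↔
      m = m' ∧ ∀ i, m ∈ Λ i
  | 0, X, _, s, Λ, h, m, m' => by
    have h0 : (List.ofFn fun i => nestedIn 0 X i (s i)).prod = s 0 := by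
      rw [List.ofFn_succ, List.ofFn_zero, List.prod_singleton]
      rfl
    rw [h0, Fin.forall_fin_one]
    exact h 0 m m'
  | n + 1, X, hX, s, Λ, h, m, m' => by
    have ih := conj_prod_ofFn_nestedIn_iff (fun i => hX i.castSucc) (fun i => s i.castSucc)
      (fun i => Λ i.castSucc) fun i => h i.castSucc
    set N := nested n fun i => X i.castSucc with hN
    have hNi : Function.Injective N.hom := nested_hom_injective fun i => hX i.castSucc
    set w := (List.ofFn fun i : Fin (n + 1) =>
      nestedIn n (fun i => X i.castSucc) i (s i.castSucc)).prod with hw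
    set v := nestedIn (n + 1) X (Fin.last (n + 1)) with hv
    have hprod : (List.ofFn fun i => nestedIn (n + 1) X i (s i)).prod =
        nestedInit X w * v (s (Fin.last (n + 1))) := by
      rw [List.ofFn_succ', List.concat_eq_append, List.prod_append, List.prod_singleton, hw,
        map_list_prod, List.map_ofFn]
      congr 3
      funext i
      rw [nestedIn_castSucc]
      rfl
    rw [hprod, Fin.forall_fin_succ']
    have hconj : (nestedInit X w * v (s (Fin.last (n + 1))))⁻¹ *
        (nested (n + 1) X).hom m * (nestedInit X w * v (s (Fin.last (n + 1)))) =
        (v (s (Fin.last (n + 1))))⁻¹ * nestedInit X (w⁻¹ * N.hom m * w) *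
          v (s (Fin.last (n + 1))) := by
      rw [← nestedInit_hom X m, map_mul, map_mul, map_inv, mul_inv_rev]
      simp only [mul_assoc]
      rfl
    rw [hconj, ← nestedIn_hom X (Fin.last (n + 1)) m']
    constructor
    · intro he
      rw [mul_assoc, inv_mul_eq_iff_eq_mul, ← eq_mul_inv_iff_mul_eq, ← map_inv, ← map_mul,
        ← map_mul, hv, nestedIn_last] at he
      -- The conjugate by `w` lies in the initial amalgam and, after moving the last letter across,
      -- also in the last factor; hence it is some `k` in `M`.
      obtain ⟨k, hk, hk'⟩ := amalgam.exists_hom_eq hNi (hX _) he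
      obtain ⟨rfl, hΛ⟩ := (ih m k).1 hk.symm
      have hlast := (h (Fin.last (n + 1)) m m').1 (by
        rw [hk']
        group)
      exact ⟨hlast.1, hΛ, hlast.2⟩
    · rintro ⟨rfl, hΛ, hlast⟩
      rw [(ih m m).2 ⟨rfl, hΛ⟩, nestedInit_hom, ← nestedIn_hom X (Fin.last (n + 1)), ← map_inv,
        ← map_mul, ← map_mul]
      exact congrArg _ ((h (Fin.last (n + 1)) m m).2 ⟨rfl, hlast⟩)

end Nested

end StarConstruction

/-! ### The star construction: embedding, universal property, traces on the amalgamated subgroup. -/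

namespace StarConstruction

open Monoid

section Star

variable {M : Type u} [Group M] {n : ℕ} {K : Fin (n + 1) → Type u} [∀ i, Group (K i)]
  (φ : ∀ i, M →* K i) (L : ∀ i, Subgroup (K i))

variable {φ} in
theorem factor_hom_injective (hφ : ∀ i, Function.Injective (φ i)) (i : Fin (n + 1)) :
    Function.Injective (factor φ L i).hom :=
  (HNNExtension.of_injective (φ := MulEquiv.refl (L i))).comp (hφ i)

variable {φ} in
theorem Star.base_injective (hφ : ∀ i, Function.Injective (φ i)) :
    Function.Injective (Star.base φ L) :=
  nested_hom_injective (factor_hom_injective L hφ)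

theorem Star.of_apply (i : Fin (n + 1)) (m : M) : Star.of φ L i (φ i m) = Star.base φ L m :=
  nestedIn_hom (factor φ L) i m

theorem Star.inv_t_mul_of_mul_t {i : Fin (n + 1)} {x : K i} (hx : x ∈ L i) :
    (Star.t φ L i)⁻¹ * Star.of φ L i x * Star.t φ L i = Star.of φ L i x := by
  have h := congrArg (nestedIn n (factor φ L) i) (HNNExtension.inv_t_mul_of_mul_t hx)
  have h' : nestedIn n (factor φ L) i ((factorT φ L i)⁻¹ * factorOf φ L i x * factorT φ L i) =
      nestedIn n (factor φ L) i (factorOf φ L i x) := h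
  rw [map_mul, map_mul, map_inv] at h'
  exact h'

theorem Star.exists_lift {Q : Type*} [Group Q] (f : ∀ i, K i →* Q) (b : M →* Q)
    (hf : ∀ i, (f i).comp (φ i) = b) (τ : Fin (n + 1) → Q)
    (hτ : ∀ i, ∀ l ∈ L i, τ i * f i l = f i l * τ i) :
    ∃ F : Star φ L →* Q, (∀ i x, F (Star.of φ L i x) = f i x) ∧ ∀ i, F (Star.t φ L i) = τ i := by
  let k : ∀ i, (factor φ L i).carrier →* Q := fun i =>
    HNNExtension.lift (φ := MulEquiv.refl (L i)) (f i) (τ i) fun l => hτ i l l.2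
  have hk : ∀ i x, k i (factorOf φ L i x) = f i x := fun i x => HNNExtension.lift_of ..
  obtain ⟨F, -, hF⟩ := nested_exists_lift b (factor φ L) k fun i => by
    rw [← hf i]
    exact MonoidHom.ext fun m => hk i (φ i m)
  refine ⟨F, fun i x => ?_, fun i => ?_⟩
  · exact (DFunLike.congr_fun (hF i) (factorOf φ L i x)).trans (hk i x)
  · exact (DFunLike.congr_fun (hF i) (factorT φ L i)).trans (HNNExtension.lift_t ..)

theorem Star.eq_top_of_mem {S : Subgroup (Star φ L)} (hof : ∀ i x, Star.of φ L i x ∈ S)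
    (ht : ∀ i, Star.t φ L i ∈ S) : S = ⊤ := by
  rw [eq_top_iff]
  refine (iSup_range_nestedIn (factor φ L)).ge.trans (iSup_le fun i => ?_)
  rintro _ ⟨z, rfl⟩
  change HNNExtension (K i) (L i) (L i) (MulEquiv.refl (L i)) at z
  change z ∈ S.comap (nestedIn n (factor φ L) i)
  induction z using HNNExtension.induction_on with
  | of x => exact hof i x
  | t => exact ht i
  | mul x y hx hy => exact mul_mem hx hy
  | inv x hx => exact inv_mem hx

variable {φ} in
theorem Star.conj_prod_t_iff (hφ : ∀ i, Function.Injective (φ i)) (m m' : M) :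
    (List.ofFn (Star.t φ L)).prod⁻¹ * Star.base φ L m * (List.ofFn (Star.t φ L)).prod =
      Star.base φ L m' ↔ m = m' ∧ ∀ i, φ i m ∈ L i := by
  refine conj_prod_ofFn_nestedIn_iff (X := factor φ L) (factor_hom_injective L hφ) (factorT φ L)
    (fun i => (L i).comap (φ i)) (fun i m m' => ?_) m m'
  refine (HNNExtension.inv_t_mul_of_mul_t_eq_of_iff (L := L i)).trans ?_
  rw [(hφ i).eq_iff, Subgroup.mem_comap]

variable {φ L} in
/-- If a subgroup `H` of `M` meets every `L i` in a subgroup of `J ≤ H`, then the conjugates of `H`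
by the stable letters generate a subgroup meeting `M` in a subgroup of `J`. -/
theorem Star.comap_iSup_conjBy_le (hφ : ∀ i, Function.Injective (φ i)) {H J : Subgroup M}
    (hJH : J ≤ H) (hJ : ∀ i, H ⊓ (L i).comap (φ i) ≤ J) :
    (⨆ i, (H.map (Star.base φ L)).conjBy (Star.t φ L i)).comap (Star.base φ L) ≤ J := by
  -- Adjoining `J` to each conjugate of `H` makes all traces on `M` equal to `J`, as the amalgam
  -- argument requires a common trace.
  let S : ∀ i, Subgroup (factor φ L i).carrier := fun i =>
    ((J.map (φ i)).map (factorOf φ L i)) ⊔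
      ((H.map (φ i)).map (factorOf φ L i)).conjBy (factorT φ L i)
  have hS : ∀ i, (S i).comap (factor φ L i).hom = J := by
    intro i
    refine le_antisymm (fun m hm => ?_) fun m hm => ?_
    · have hinf : J.map (φ i) ⊓ L i = H.map (φ i) ⊓ L i := by
        refine le_antisymm (inf_le_inf_right _ (Subgroup.map_mono hJH)) ?_
        rintro _ ⟨⟨h, hh, rfl⟩, hl⟩
        exact ⟨⟨h, hJ i ⟨hh, hl⟩, rfl⟩, hl⟩
      have h1 : φ i m ∈ J.map (φ i) := HNNExtension.mem_of_of_mem_sup_conjBy hinf hm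
      exact (Subgroup.mem_map_iff_mem (hφ i)).1 h1
    · exact Subgroup.mem_sup_left ⟨φ i m, ⟨m, hm, rfl⟩, rfl⟩
  refine le_trans (Subgroup.comap_mono (iSup_mono fun i => ?_))
    (comap_iSup_map_nestedIn (factor_hom_injective L hφ) S hS).le
  rintro _ ⟨_, ⟨h, hh, rfl⟩, rfl⟩
  refine ⟨(factorT φ L i)⁻¹ * factorOf φ L i (φ i h) * factorT φ L i,
    Subgroup.mem_sup_right ⟨_, ⟨_, ⟨h, hh, rfl⟩, rfl⟩, by simp⟩, ?_⟩
  rw [← Star.of_apply φ L i h, map_mul, map_mul, map_inv]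
  simp only [MulEquiv.coe_toMonoidHom, MulAut.conj_apply, inv_inv]
  rfl

end Star

/-! ### The finite presentation. -/

section Presentation

variable {M : Type u} [Group M] {n : ℕ} {K : Fin (n + 1) → Type u} [∀ i, Group (K i)]
  {φ : ∀ i, M →* K i} {L : ∀ i, Subgroup (K i)} {α : Fin (n + 1) → Type}
  {π : ∀ i, FreeGroup (α i) →* K i} {σ : Type}

theorem Star.eval_inr (i : Fin (n + 1)) :
    Star.eval φ L π (FreeGroup.of (Sum.inr i)) = Star.t φ L i := by
  simp [Star.eval]

theorem Star.eval_inclWord (i : Fin (n + 1)) (w : FreeGroup (α i)) :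
    Star.eval φ L π (inclWord i w) = Star.of φ L i (π i w) := by
  have : (Star.eval φ L π).comp (inclWord i) = (Star.of φ L i).comp (π i) := by
    ext a
    simp [Star.eval, inclWord]
  exact DFunLike.congr_fun this w

theorem Star.eval_surjective (hπ : ∀ i, Function.Surjective (π i)) :
    Function.Surjective (Star.eval φ L π) := by
  rw [← MonoidHom.range_eq_top]
  refine Star.eq_top_of_mem φ L (fun i x => ?_) fun i => ⟨_, Star.eval_inr i⟩
  obtain ⟨w, rfl⟩ := hπ i x
  exact ⟨_, Star.eval_inclWord i w⟩

theorem starRelators_finite [Finite σ] {R W : ∀ i, Set (FreeGroup (α i))}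
    (hR : ∀ i, (R i).Finite) (hW : ∀ i, (W i).Finite) (m : ∀ i, σ → FreeGroup (α i)) :
    (starRelators R W m).Finite := by
  refine Set.Finite.union (Set.Finite.union ?_ ?_) ?_
  · refine (Set.finite_iUnion fun i => (hR i).image (inclWord i)).subset ?_
    rintro _ ⟨i, r, hr, rfl⟩
    exact Set.mem_iUnion.2 ⟨i, r, hr, rfl⟩
  · refine (Set.finite_iUnion fun i => (hW i).image fun w => (FreeGroup.of (Sum.inr i))⁻¹ *
      inclWord i w * FreeGroup.of (Sum.inr i) * (inclWord i w)⁻¹).subset ?_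
    rintro _ ⟨i, w, hw, rfl⟩
    exact Set.mem_iUnion.2 ⟨i, w, hw, rfl⟩
  · refine (Set.finite_range fun p : Fin (n + 1) × Fin (n + 1) × σ =>
      inclWord p.1 (m p.1 p.2.2) * (inclWord p.2.1 (m p.2.1 p.2.2))⁻¹).subset ?_
    rintro _ ⟨i, j, s, rfl⟩
    exact ⟨⟨i, j, s⟩, rfl⟩

/-- The universal property yields a map from the star construction back to the presented group, and
its composite with evaluation is the quotient map; so every word that evaluates to 1 is a
consequence of the relators. -/
theorem Star.ker_eval (hπ : ∀ i, Function.Surjective (π i)) {R W : ∀ i, Set (FreeGroup (α i))}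
    (hR : ∀ i, (π i).ker = Subgroup.normalClosure (R i))
    (hW : ∀ i, Subgroup.closure (π i '' W i) = L i) {g : σ → M}
    (hg : Subgroup.closure (Set.range g) = ⊤) {m : ∀ i, σ → FreeGroup (α i)}
    (hm : ∀ i s, π i (m i s) = φ i (g s)) :
    (Star.eval φ L π).ker = Subgroup.normalClosure (starRelators R W m) := by
  refine le_antisymm ?_ (Subgroup.normalClosure_le_normal ?_)
  · let N := Subgroup.normalClosure (starRelators R W m)
    let q := QuotientGroup.mk' N
    have hq : ∀ x ∈ starRelators R W m, q x = 1 := fun x hx =>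
      (QuotientGroup.eq_one_iff x).2 (Subgroup.subset_normalClosure hx)
    have hker : ∀ i, (π i).ker ≤ (q.comp (inclWord i)).ker := fun i => by
      rw [hR]
      exact Subgroup.normalClosure_le_normal fun r hr => hq _ (Or.inl (Or.inl ⟨i, r, hr, rfl⟩))
    let f : ∀ i, K i →* _ := fun i => (π i).liftOfSurjective (hπ i) ⟨_, hker i⟩
    have hf : ∀ i w, f i (π i w) = q (inclWord i w) := fun i w =>
      (π i).liftOfRightInverse_comp_apply _ _ ⟨_, hker i⟩ w
    obtain ⟨F, hFo, hFt⟩ := Star.exists_lift φ L f ((f 0).comp (φ 0)) (fun i => by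
      refine MonoidHom.eq_of_eqOn_dense hg ?_
      rintro _ ⟨s, rfl⟩
      have := hq _ (Or.inr ⟨i, 0, s, rfl⟩)
      rw [map_mul, map_inv, mul_inv_eq_one] at this
      rw [MonoidHom.comp_apply, MonoidHom.comp_apply, ← hm, ← hm, hf, hf, this])
      (fun i => q (FreeGroup.of (Sum.inr i))) (fun i l hl => by
      -- The relators only make `t_i` commute with generators of `L i`; centralizers being
      -- subgroups, this extends to all of `L i`.
      have hle : L i ≤ (Subgroup.centralizer {q (FreeGroup.of (Sum.inr i))}).comap (f i) := by
        rw [← hW i, Subgroup.closure_le]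
        rintro _ ⟨w, hw, rfl⟩
        have := hq _ (Or.inl (Or.inr ⟨i, w, hw, rfl⟩))
        rw [map_mul, map_inv, mul_inv_eq_one, map_mul, map_mul, map_inv, mul_assoc,
          inv_mul_eq_iff_eq_mul] at this
        rw [SetLike.mem_coe, Subgroup.mem_comap, hf, Subgroup.mem_centralizer_singleton_iff]
        exact this
      exact (Subgroup.mem_centralizer_singleton_iff.1 (Subgroup.mem_comap.1 (hle hl))).symm)
    have hcomp : F.comp (Star.eval φ L π) = q := by
      ext (⟨i, a⟩ | i)
      · have h := congrArg F (Star.eval_inclWord (φ := φ) (L := L) (π := π) i (FreeGroup.of a))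
        rw [hFo, hf] at h
        simpa [inclWord] using h
      · exact (congrArg F (Star.eval_inr i)).trans (hFt i)
    intro x hx
    rw [← QuotientGroup.eq_one_iff (N := N)]
    have : q x = 1 := by
      rw [← hcomp, MonoidHom.comp_apply, MonoidHom.mem_ker.1 hx, map_one]
    exact this
  · rintro _ ((⟨i, r, hr, rfl⟩ | ⟨i, w, hw, rfl⟩) | ⟨i, j, s, rfl⟩)
    · have : r ∈ (π i).ker := hR i ▸ Subgroup.subset_normalClosure hr
      rw [SetLike.mem_coe, MonoidHom.mem_ker, Star.eval_inclWord, MonoidHom.mem_ker.1 this, map_one]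
    · have : π i w ∈ L i := hW i ▸ Subgroup.subset_closure ⟨w, hw, rfl⟩
      rw [SetLike.mem_coe, MonoidHom.mem_ker, map_mul, map_mul, map_mul, map_inv, map_inv,
        Star.eval_inclWord, Star.eval_inr, Star.inv_t_mul_of_mul_t φ L this, mul_inv_cancel]
    · rw [SetLike.mem_coe, MonoidHom.mem_ker, map_mul, map_inv, Star.eval_inclWord,
        Star.eval_inclWord, hm, hm, Star.of_apply, Star.of_apply, mul_inv_cancel]

theorem Star.isFinitelyPresented [Group.FG M] [∀ i, Group.IsFinitelyPresented (K i)]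
    (φ : ∀ i, M →* K i) (hL : ∀ i, (L i).FG) : Group.IsFinitelyPresented (Star φ L) := by
  choose d π hπ R hRf hR using fun i => Group.IsFinitelyPresented.out (G := K i)
  choose T hT hTf using fun i => (Subgroup.fg_iff (L i)).1 (hL i)
  let W : ∀ i, Set (FreeGroup (Fin (d i))) := fun i => Function.surjInv (hπ i) '' T i
  have hW : ∀ i, Subgroup.closure (π i '' W i) = L i := fun i => by
    rw [← hT i, Set.image_image]
    simp [Function.surjInv_eq]
  obtain ⟨S, hS, hSf⟩ := Group.fg_iff.1 ‹Group.FG M›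
  obtain ⟨k, g, -, rfl⟩ := hSf.fin_param
  have hm : ∀ i s, π i (Function.surjInv (hπ i) (φ i (g s))) = φ i (g s) :=
    fun i s => Function.surjInv_eq _ _
  refine Group.IsFinitelyPresented.of_surjective (Star.eval φ L π) (Star.eval_surjective hπ)
    ⟨_, starRelators_finite hRf (fun i => (hTf i).image _) _,
      (Star.ker_eval hπ (fun i => (hR i).symm) hW hS hm).symm⟩

end Presentation

end StarConstruction

/-! ### Traces of the two subgroups on `G`, and the corollary. -/

theorem Subgroup.mem_conjBy {K : Type u} [Group K] {H : Subgroup K} {w x : K} :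
    x ∈ H.conjBy w ↔ ∃ h ∈ H, w⁻¹ * h * w = x := by
  simp [Subgroup.conjBy, Subgroup.mem_map]

theorem Subgroup.fg_conjBy_range {G K : Type u} [Group G] [Group.FG G] [Group K] (f : G →* K)
    (w : K) : (f.range.conjBy w).FG := by
  rw [Subgroup.conjBy, MonoidHom.map_range]
  exact (Group.fg_iff_subgroup_fg _).1 (Group.fg_range _)

namespace StarConstruction

variable {G M : Type u} [Group G] [Group M] {n : ℕ} {K : Fin (n + 1) → Type u}
  [∀ i, Group (K i)] {φ : ∀ i, M →* K i} {L : ∀ i, Subgroup (K i)} {A : Fin (n + 1) → Subgroup G}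
  {j : G →* M}

theorem Star.comap_conjBy_prod_t (hj : Function.Injective j) (hφ : ∀ i, Function.Injective (φ i))
    (hA : ∀ i, (L i).comap ((φ i).comp j) = A i) :
    (((Star.base φ L).comp j).range.conjBy (List.ofFn (Star.t φ L)).prod).comap
      ((Star.base φ L).comp j) = ⨅ i, A i := by
  ext g
  rw [Subgroup.mem_comap, Subgroup.mem_conjBy, Subgroup.mem_iInf]
  simp only [← hA]
  constructor
  · rintro ⟨_, ⟨g', rfl⟩, h⟩
    obtain ⟨h1, h2⟩ := (Star.conj_prod_t_iff L hφ (j g') (j g)).1 h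
    rw [hj h1] at h2
    exact h2
  · exact fun h => ⟨_, ⟨g, rfl⟩, (Star.conj_prod_t_iff L hφ (j g) (j g)).2 ⟨rfl, h⟩⟩

theorem Star.comap_iSup_conjBy_t (hj : Function.Injective j) (hφ : ∀ i, Function.Injective (φ i))
    (hA : ∀ i, (L i).comap ((φ i).comp j) = A i) :
    (⨆ i, ((Star.base φ L).comp j).range.conjBy (Star.t φ L i)).comap
      ((Star.base φ L).comp j) = ⨆ i, A i := by
  refine le_antisymm (fun g hg => ?_) (iSup_le fun i g hg => ?_)
  · have h := Star.comap_iSup_conjBy_le (φ := φ) (L := L) hφ (H := j.range)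
      (J := (⨆ i, A i).map j) (Subgroup.map_le_range _ _) (fun i => by
        rintro _ ⟨⟨a, rfl⟩, ha⟩
        refine ⟨a, (le_iSup A i) ?_, rfl⟩
        rw [← hA i]
        exact ha)
    refine (Subgroup.mem_map_iff_mem hj).1 (h ?_)
    rw [← MonoidHom.range_comp]
    exact hg
  · refine Subgroup.mem_comap.2 (le_iSup (fun i => Subgroup.conjBy _ (Star.t φ L i)) i
      (Subgroup.mem_conjBy.2 ⟨_, ⟨g, rfl⟩, ?_⟩))
    rw [← hA i] at hg
    have := Star.inv_t_mul_of_mul_t φ L (i := i) (x := φ i (j g)) hg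
    rwa [Star.of_apply] at this

end StarConstruction

theorem corollary4p5 {G : Type u} [Group G] [Group.FG G] {n : ℕ}
    (A : Fin (n + 1) → Subgroup G) (hA : ∀ i, (A i).IsBenign) :
    (⨅ i, A i).IsBenign ∧ (⨆ i, A i).IsBenign ∧
    -- the explicit overgroup and subgroups, from any witnesses `K i`, `L i` for the `A i`
    ∀ (M : Type u) [Group M] [Group.FG M] (j : G →* M) (_ : Function.Injective j)
      (K : Fin (n + 1) → Type u) [∀ i, Group (K i)] [∀ i, Group.IsFinitelyPresented (K i)]
      (φ : ∀ i, M →* K i) (_ : ∀ i, Function.Injective (φ i))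
      (L : ∀ i, Subgroup (K i)) (_ : ∀ i, (L i).FG)
      (_ : ∀ i, (L i).comap ((φ i).comp j) = A i),
      let ι : G →* StarConstruction.Star φ L := (StarConstruction.Star.base φ L).comp j
      let t : Fin (n + 1) → StarConstruction.Star φ L := StarConstruction.Star.t φ L
      let L_I : Subgroup (StarConstruction.Star φ L) := ι.range.conjBy (List.ofFn t).prod
      let L_J : Subgroup (StarConstruction.Star φ L) := ⨆ i, ι.range.conjBy (t i)
      Group.IsFinitelyPresented (StarConstruction.Star φ L) ∧ Function.Injective ι ∧
      (L_I.FG ∧ L_I.comap ι = ⨅ i, A i) ∧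
      (L_J.FG ∧ L_J.comap ι = ⨆ i, A i) ∧
      -- the finite presentation of the overgroup obtained from finite presentations of the `K i`
      ∀ (α : Fin (n + 1) → Type) [∀ i, Finite (α i)] (π : ∀ i, FreeGroup (α i) →* K i)
        (_ : ∀ i, Function.Surjective (π i)) (R : ∀ i, Set (FreeGroup (α i)))
        (_ : ∀ i, (R i).Finite) (_ : ∀ i, (π i).ker = Subgroup.normalClosure (R i))
        (W : ∀ i, Set (FreeGroup (α i))) (_ : ∀ i, (W i).Finite)
        (_ : ∀ i, Subgroup.closure (π i '' W i) = L i)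
        (σ : Type) [Finite σ] (g : σ → M) (_ : Subgroup.closure (Set.range g) = ⊤)
        (m : ∀ i, σ → FreeGroup (α i)) (_ : ∀ i s, π i (m i s) = φ i (g s)),
        Function.Surjective (StarConstruction.Star.eval φ L π) ∧
        (StarConstruction.Star.eval φ L π).ker =
          Subgroup.normalClosure (StarConstruction.starRelators R W m) ∧
        (StarConstruction.starRelators R W m).Finite := by
  have main : ∀ (M : Type u) [Group M] [Group.FG M] (j : G →* M) (_ : Function.Injective j)
      (K : Fin (n + 1) → Type u) [∀ i, Group (K i)] [∀ i, Group.IsFinitelyPresented (K i)]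
      (φ : ∀ i, M →* K i) (_ : ∀ i, Function.Injective (φ i))
      (L : ∀ i, Subgroup (K i)) (_ : ∀ i, (L i).FG)
      (_ : ∀ i, (L i).comap ((φ i).comp j) = A i),
      let ι : G →* StarConstruction.Star φ L := (StarConstruction.Star.base φ L).comp j
      let t : Fin (n + 1) → StarConstruction.Star φ L := StarConstruction.Star.t φ L
      let L_I : Subgroup (StarConstruction.Star φ L) := ι.range.conjBy (List.ofFn t).prod
      let L_J : Subgroup (StarConstruction.Star φ L) := ⨆ i, ι.range.conjBy (t i)
      Group.IsFinitelyPresented (StarConstruction.Star φ L) ∧ Function.Injective ι ∧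
      (L_I.FG ∧ L_I.comap ι = ⨅ i, A i) ∧ (L_J.FG ∧ L_J.comap ι = ⨆ i, A i) := by
    intro M _ _ j hj K _ _ φ hφ L hL hLA ι t L_I L_J
    exact ⟨StarConstruction.Star.isFinitelyPresented φ hL,
      (StarConstruction.Star.base_injective L hφ).comp hj,
      ⟨Subgroup.fg_conjBy_range ι _, StarConstruction.Star.comap_conjBy_prod_t hj hφ hLA⟩,
      ⟨Subgroup.FG.iSup _ fun i => Subgroup.fg_conjBy_range ι _,
        StarConstruction.Star.comap_iSup_conjBy_t hj hφ hLA⟩⟩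
  choose K hK ι L hfp hι hL hLA using hA
  -- For benignness alone, `M = G` suffices.
  obtain ⟨h1, h2, ⟨h3, h4⟩, h5, h6⟩ := main G (MonoidHom.id G) Function.injective_id K ι hι L hL hLA
  refine ⟨⟨_, _, _, _, h1, h2, h3, h4⟩, ⟨_, _, _, _, h1, h2, h5, h6⟩, ?_⟩
  intro M _ _ j hj K _ _ φ hφ L hL hLA ι t L_I L_J
  obtain ⟨h1, h2, h3, h4⟩ := main M j hj K φ hφ L hL hLA
  refine ⟨h1, h2, h3, h4, ?_⟩
  intro α _ π hπ R hRf hR W hWf hW σ _ g hg m hm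
  exact ⟨StarConstruction.Star.eval_surjective hπ,
    StarConstruction.Star.ker_eval hπ hR hW hg hm,
    StarConstruction.starRelators_finite hRf hWf m⟩
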